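/- Let $n \ge 3$ and let $F\colon \mathbb{F}_2^n \to \mathbb{F}_2^n$. For $a \in \mathbb{F}_2^n$ write $D_aF(x) = F(x) + F(x+a)$. Assume that $F$ is quadratic (every derivative $D_aF$ is an affine function) and almost perfect nonlinear (for all $a \ne 0$ and all $b$, the equation $D_aF(x) = b$ has at most $2$ solutions $x \in \mathbb{F}_2^n$). Let $\mathcal{G}_F = \{(x, F(x)) : x \in \mathbb{F}_2^n\}$ be the graph of $F$. For $(a,b) \in (\mathbb{F}_2^n)^2 \setminus \mathcal{G}_F$, let the exclude multiplicity $\mathrm{mult}_{\mathcal{G}_F}(a,b)$ be the number of three-element subsets $\{x,y,z\} \subseteq \mathcal{G}_F$ with $x+y+z = (a,b)$. Let $\mathcal{B}(F)$ be the set of all $v \in \mathbb{F}_2^n$ such that the Boolean function $x \mapsto v \cdot F(x)$ is bent, where $\cdot$ is the standard inner product and $f\colon \mathbb{F}_2^n \to \mathbb{F}_2$ is called bent if $\max_{u \in \mathbb{F}_2^n} \bigl|\sum_{x \in \mathbb{F}_2^n} (-1)^{f(x) + x\cdot u}\bigr| = 2^{n/2}$. Then: 1. $\mathrm{mult}_{\mathcal{G}_F}(a,b)$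 is odd for every $(a,b) \in (\mathbb{F}_2^n)^2 \setminus \mathcal{G}_F$; 2. consequently, $|\mathcal{B}(F) \cap H|$ is even for every affine hyperplane $H$ of $\mathbb{F}_2^n$. -/

import Mathlib

/-- The space of bit vectors of length `n`, with its standard structure over `ZMod 2`. -/
abbrev BitVec2 (n : ℕ) : Type := Fin n → ZMod 2

/-- The derivative of `F` in the direction `a`. -/
def derivDir {n : ℕ} (F : BitVec2 n → BitVec2 n) (a x : BitVec2 n) : BitVec2 n :=
  F x + F (x + a)

/-- Almost perfect nonlinear: for `a ≠ 0`, each equation `D_a F (x) = b` has at most two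
solutions. -/
def IsAPN {n : ℕ} (F : BitVec2 n → BitVec2 n) : Prop :=
  ∀ a : BitVec2 n, a ≠ 0 → ∀ b : BitVec2 n,
    (Finset.univ.filter fun x : BitVec2 n => derivDir F a x = b).card ≤ 2

/-- `F` is quadratic if each of its derivatives is an affine function. -/
def IsQuadratic {n : ℕ} (F : BitVec2 n → BitVec2 n) : Prop :=
  ∀ a : BitVec2 n, ∃ g : BitVec2 n →ᵃ[ZMod 2] BitVec2 n, ∀ x, derivDir F a x = g x

/-- The graph of `F`, as a finite set of pairs. -/
def graphFinset {n : ℕ} (F : BitVec2 n → BitVec2 n) : Finset (BitVec2 n × BitVec2 n) :=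
  Finset.univ.filter fun p => p.2 = F p.1

/-- The exclude multiplicity of `p` with respect to `S`: the number of three-element subsets
of `S` whose elements sum to `p`. -/
def excludeMult {G : Type*} [AddCommGroup G] [DecidableEq G] (S : Finset G) (p : G) : ℕ :=
  ((S.powersetCard 3).filter fun T => ∑ x ∈ T, x = p).card

/-- The Walsh transform of a Boolean function. -/
def walsh {n : ℕ} (f : BitVec2 n → ZMod 2) (u : BitVec2 n) : ℤ :=
  ∑ x : BitVec2 n, (-1 : ℤ) ^ (f x + x ⬝ᵥ u).val

/-- The linearity of a Boolean function: the largest absolute value of its Walsh transform. -/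
def linearity {n : ℕ} (f : BitVec2 n → ZMod 2) : ℕ :=
  Finset.univ.sup fun u : BitVec2 n => (walsh f u).natAbs

/-- A Boolean function in `n` variables is bent if its linearity is `2 ^ (n / 2)`, where `n / 2`
is a real number. -/
def IsBent {n : ℕ} (f : BitVec2 n → ZMod 2) : Prop :=
  (linearity f : ℝ) = (2 : ℝ) ^ ((n : ℝ) / 2)

/-- The set of all `v` for which the component function `v · F` is bent. -/
def bentComponents {n : ℕ} (F : BitVec2 n → BitVec2 n) : Set (BitVec2 n) :=
  {v | IsBent fun x => v ⬝ᵥ F x}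

/-- An affine hyperplane: a nonempty affine subspace whose direction has dimension `n - 1`. -/
def IsAffineHyperplane {n : ℕ} (H : AffineSubspace (ZMod 2) (BitVec2 n)) : Prop :=
  (H : Set (BitVec2 n)).Nonempty ∧ Module.finrank (ZMod 2) H.direction + 1 = n

/-! Since F is quadratic, B(s,t) = F(s+t) + F(s) + F(t) + F(0) is an alternating bilinear map. Let
M_v be the Gram matrix of v · B. The squared Walsh values of v · F are 2^n times signed sums over
the radical of v · B, so v · F is bent iff det M_v ≠ 0. Both claims rest on one identity: the sum of
det M_v over an affine subspace of dimension above n/2 is 0 in 𝔽₂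
(`sum_affineSubspace_det_eq_zero`). The reason is that, as a function of v, an alternating
determinant over 𝔽₂ has degree at most n/2. For n ≥ 3 this applies to hyperplanes, which gives the
second claim at once. For the first claim, let N(c) count the pairs with B(s,t) = c. Character sums
give N(0) + N(c) = 2 ∑ |rad(v · B)| over the v orthogonal to c. Since |rad(v · B)| ≡ det M_v mod 2,
it follows that 4 ∣ N(0) + N(c). APN forces N(0) = 3·2^n - 2, and N(b + F(a)) is six times the
multiplicity at (a,b), which is therefore odd. -/

/-! ### Sums of alternating determinants over affine subspaces -/

/-- Fewer linear forms than the dimension share a nonzero zero w in the direction of H; translation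
by w pairs off points of H with equal products. -/
theorem sum_affineSubspace_prod_eq_zero {V ι : Type*} [AddCommGroup V] [Module (ZMod 2) V]
    [Fintype V] (H : AffineSubspace (ZMod 2) V) [DecidablePred (· ∈ H)] (S : Finset ι)
    (L : ι → V →ₗ[ZMod 2] ZMod 2) (hS : S.card < Module.finrank (ZMod 2) H.direction) :
    ∑ v with v ∈ H, ∏ i ∈ S, L i v = 0 := by
  obtain ⟨w, hw, hw0⟩ : ∃ w ∈ (LinearMap.pi fun i : S => (L i).comp H.direction.subtype).ker,
      w ≠ 0 := by
    apply Submodule.exists_mem_ne_zero_of_ne_bot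
    apply LinearMap.ker_ne_bot_of_finrank_lt
    simpa using hS
  have hL : ∀ i ∈ S, L i w = 0 := fun i hi => congrFun (LinearMap.mem_ker.1 hw) ⟨i, hi⟩
  refine Finset.sum_involution (fun v _ => (w : V) + v) ?_ ?_ ?_ ?_
  · intro v _
    have : ∏ i ∈ S, L i (w + v) = ∏ i ∈ S, L i v :=
      Finset.prod_congr rfl fun i hi => by rw [map_add, hL i hi, zero_add]
    rw [this, CharTwo.add_self_eq_zero]
  · intro v _ _ h
    exact hw0 (Subtype.ext (by simpa using h))
  · intro v hv
    simpa using AffineSubspace.vadd_mem_of_mem_direction w.2 (by simpa using hv)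
  · intro v _
    have : (w : V) + w = 0 := by rw [← two_smul (ZMod 2) (w : V)]; exact zero_smul _ _
    rw [← add_assoc, this, zero_add]

theorem two_mul_card_filter_lt_le {m : Type*} [Fintype m] [LinearOrder m] (σ : Equiv.Perm m)
    (hσ : ∀ i, σ (σ i) = i) : 2 * (Finset.univ.filter fun i => i < σ i).card ≤ Fintype.card m := by
  have h : (Finset.univ.filter fun i => σ i < i).card =
      (Finset.univ.filter fun i => i < σ i).card :=
    Finset.card_equiv σ fun i => by simp [hσ]
  have hd : Disjoint (Finset.univ.filter fun i => σ i < i)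
      (Finset.univ.filter fun i => i < σ i) := by
    rw [Finset.disjoint_filter]
    intro i _ h1 h2
    exact lt_asymm h1 h2
  calc _ = _ := by rw [Finset.card_union_of_disjoint hd, h, two_mul]
    _ ≤ _ := Finset.card_le_univ _

theorem prod_eq_prod_filter_lt {m : Type*} [Fintype m] [LinearOrder m] (σ : Equiv.Perm m)
    (hσ : ∀ i, σ (σ i) = i) (hfix : ∀ i, σ i ≠ i) (x : m → ZMod 2) (hx : ∀ i, x (σ i) = x i) :
    ∏ i, x i = ∏ i with i < σ i, x i := by
  have h : ∏ i with ¬ i < σ i, x i = ∏ i with i < σ i, x i := by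
    refine Finset.prod_equiv σ (fun i => ?_) fun i _ => (hx i).symm
    have := hfix i
    simp only [Finset.mem_filter_univ, hσ, not_lt]
    exact ⟨fun h => lt_of_le_of_ne h this, le_of_lt⟩
  rw [← Finset.prod_filter_mul_prod_filter_not Finset.univ (fun i => i < σ i), h]
  -- Each 2-cycle contributes a square, and squares collapse in 𝔽₂; this halves the degree.
  have key : ∀ z : ZMod 2, z * z = z := by decide
  exact key _

/-- In the Leibniz expansion signs disappear, and by symmetry σ and σ⁻¹ give equal terms, which
cancel. An involution with a fixed point meets the zero diagonal; one without is a product of at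
most |m|/2 linear forms in v, whose sum over H vanishes. -/
theorem sum_affineSubspace_det_eq_zero {V m : Type*} [AddCommGroup V] [Module (ZMod 2) V]
    [Fintype V] [Fintype m] [LinearOrder m] (H : AffineSubspace (ZMod 2) V)
    [DecidablePred (· ∈ H)] (A : V →ₗ[ZMod 2] Matrix m m (ZMod 2))
    (hsymm : ∀ v i j, A v i j = A v j i) (hdiag : ∀ v i, A v i i = 0)
    (hcard : Fintype.card m < 2 * Module.finrank (ZMod 2) H.direction) :
    ∑ v with v ∈ H, (A v).det = 0 := by
  have hsign : ∀ σ : Equiv.Perm m, ((Equiv.Perm.sign σ : ℤ) : ZMod 2) = 1 := fun σ => by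
    rcases Int.units_eq_one_or (Equiv.Perm.sign σ) with h | h <;> rw [h] <;> decide
  simp only [Matrix.det_apply', hsign, one_mul]
  rw [Finset.sum_comm]
  have hinv : ∀ v, ∀ σ : Equiv.Perm m, ∏ i, A v (σ⁻¹ i) i = ∏ i, A v (σ i) i := fun v σ => by
    rw [← Equiv.prod_comp σ]
    exact Finset.prod_congr rfl fun i _ => by rw [show σ⁻¹ (σ i) = i from σ.symm_apply_apply i, hsymm]
  refine Finset.sum_involution (fun σ _ => σ⁻¹) ?_ ?_ (fun _ _ => Finset.mem_univ _)
    fun σ _ => inv_inv σ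
  · intro σ _
    simp only [hinv]
    exact CharTwo.add_self_eq_zero _
  · intro σ _ hne hσ
    apply hne
    have hσ' : ∀ i, σ (σ i) = i := fun i => by
      have h : σ⁻¹ (σ i) = i := σ.symm_apply_apply i
      rwa [hσ] at h
    by_cases hfix : ∃ i, σ i = i
    · obtain ⟨i, hi⟩ := hfix
      exact Finset.sum_eq_zero fun v _ =>
        Finset.prod_eq_zero (Finset.mem_univ i) (by rw [hi, hdiag])
    · push Not at hfix
      rw [← sum_affineSubspace_prod_eq_zero H (Finset.univ.filter fun i => i < σ i)
        (fun i => (Matrix.entryLinearMap (ZMod 2) (ZMod 2) (σ i) i).comp A)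
        (by have := two_mul_card_filter_lt_le σ hσ'; omega)]
      refine Finset.sum_congr rfl fun v _ => ?_
      exact prod_eq_prod_filter_lt σ hσ' hfix _ fun i => by rw [hσ', hsymm]

/-! ### Characters of 𝔽₂-spaces and the bilinear map of a quadratic function -/

theorem neg_one_pow_val_add (a b : ZMod 2) :
    (-1 : ℤ) ^ (a + b).val = (-1) ^ a.val * (-1) ^ b.val := by
  revert a b; decide

theorem sum_neg_one_pow_linearMap {V : Type*} [AddCommGroup V] [Module (ZMod 2) V]
    [Fintype V] (φ : V →ₗ[ZMod 2] ZMod 2) [Decidable (∀ x, φ x = 0)] :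
    ∑ x, (-1 : ℤ) ^ (φ x).val = if ∀ x, φ x = 0 then (Fintype.card V : ℤ) else 0 := by
  split_ifs with h
  · simp [h]
  · push Not at h
    obtain ⟨w, hw⟩ := h
    have hw1 : φ w = 1 := by
      have : ∀ z : ZMod 2, z ≠ 0 → z = 1 := by decide
      exact this _ hw
    have h2 : ∑ x, (-1 : ℤ) ^ (φ (w + x)).val = ∑ x, (-1 : ℤ) ^ (φ x).val :=
      Equiv.sum_comp (Equiv.addLeft w) fun x => (-1 : ℤ) ^ (φ x).val
    have h3 : ∑ x, (-1 : ℤ) ^ (φ (w + x)).val = -∑ x, (-1 : ℤ) ^ (φ x).val := by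
      rw [← Finset.sum_neg_distrib]
      refine Finset.sum_congr rfl fun x _ => ?_
      rw [map_add, neg_one_pow_val_add, hw1, ZMod.val_one, pow_one, neg_one_mul]
    linarith

theorem BitVec2.add_self {n : ℕ} (x : BitVec2 n) : x + x = 0 :=
  funext fun i => CharTwo.add_self_eq_zero (x i)

theorem BitVec2.add_eq_zero_iff {n : ℕ} {x y : BitVec2 n} : x + y = 0 ↔ x = y := by
  rw [← BitVec2.add_self y, add_left_inj]

/-- For fixed s the expression is D_sF(t) + D_sF(0), the linear part of an affine map; symmetry then
gives linearity in s. -/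
theorem IsQuadratic.exists_bilinear {n : ℕ} {F : BitVec2 n → BitVec2 n} (hF : IsQuadratic F) :
    ∃ B : BitVec2 n →ₗ[ZMod 2] BitVec2 n →ₗ[ZMod 2] BitVec2 n,
      ∀ s t, B s t = F (s + t) + F s + F t + F 0 := by
  let b : BitVec2 n → BitVec2 n → BitVec2 n := fun s t => F (s + t) + F s + F t + F 0
  have hsymm : ∀ s t, b s t = b t s := fun s t => by
    simp only [b, add_comm s t]; abel
  have hlin : ∀ s, ∃ g : BitVec2 n →ₗ[ZMod 2] BitVec2 n, ∀ t, b s t = g t := fun s => by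
    obtain ⟨g, hg⟩ := hF s
    refine ⟨g.linear, fun t => ?_⟩
    have h1 := hg t
    have h0 := hg 0
    have h2 : g t = g.linear t + g 0 := by simpa using g.map_vadd 0 t
    have h3 : b s t = g t + g 0 := by
      rw [← h1, ← h0]
      simp only [b, derivDir, zero_add, add_comm s t]; abel
    rw [h3, h2, add_assoc, BitVec2.add_self, add_zero]
  choose g hg using hlin
  refine ⟨LinearMap.mk₂ (ZMod 2) b ?_ ?_ ?_ ?_, fun s t => rfl⟩
  · intro s s' t
    rw [hsymm, hsymm s, hsymm s', hg, hg, hg, map_add]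
  · intro c s t
    rw [hsymm, hsymm s, hg, hg, map_smul]
  · intro s t t'
    rw [hg, hg, hg, map_add]
  · intro c s t
    rw [hg, hg, map_smul]

/-! ### Radicals, Gram matrices and value counts of the components -/

section Bilinear

variable {n : ℕ}

/-- The radical of the component `v ⬝ᵥ B s t` of a vector-valued bilinear form. -/
def componentRadical (B : BitVec2 n →ₗ[ZMod 2] BitVec2 n →ₗ[ZMod 2] BitVec2 n) (v : BitVec2 n) :
    Finset (BitVec2 n) :=
  Finset.univ.filter fun s => ∀ t, v ⬝ᵥ B s t = 0

/-- The number of pairs on which a bilinear form takes the value `c`. -/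
def valueCount (B : BitVec2 n →ₗ[ZMod 2] BitVec2 n →ₗ[ZMod 2] BitVec2 n) (c : BitVec2 n) : ℕ :=
  (Finset.univ.filter fun p : BitVec2 n × BitVec2 n => B p.1 p.2 = c).card

/-- The Gram matrices of the components of a vector-valued bilinear form. -/
def componentMatrix (B : BitVec2 n →ₗ[ZMod 2] BitVec2 n →ₗ[ZMod 2] BitVec2 n) :
    BitVec2 n →ₗ[ZMod 2] Matrix (Fin n) (Fin n) (ZMod 2) where
  toFun v := Matrix.of fun i j => v ⬝ᵥ B (Pi.single j 1) (Pi.single i 1)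
  map_add' v w := by ext i j; simp [add_dotProduct]
  map_smul' c v := by ext i j; simp

variable (B : BitVec2 n →ₗ[ZMod 2] BitVec2 n →ₗ[ZMod 2] BitVec2 n)

theorem card_bitVec2 : Fintype.card (BitVec2 n) = 2 ^ n := by simp [ZMod.card]

theorem mem_componentRadical {v s : BitVec2 n} :
    s ∈ componentRadical B v ↔ ∀ t, v ⬝ᵥ B s t = 0 := Finset.mem_filter_univ _

theorem sum_neg_one_pow_component (v s : BitVec2 n) :
    ∑ t, (-1 : ℤ) ^ (v ⬝ᵥ B s t).val = if s ∈ componentRadical B v then 2 ^ n else 0 := by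
  have h := sum_neg_one_pow_linearMap ((dotProductBilin (ZMod 2) (ZMod 2) v).comp (B s))
  simp only [LinearMap.comp_apply, dotProductBilin_apply_apply, card_bitVec2] at h
  simp only [mem_componentRadical]
  exact_mod_cast h

theorem sum_neg_one_pow_dotProduct (w : BitVec2 n) :
    ∑ v, (-1 : ℤ) ^ (v ⬝ᵥ w).val = if w = 0 then 2 ^ n else 0 := by
  have h := sum_neg_one_pow_linearMap (dotProductBilin (ZMod 2) (ZMod 2) w)
  have h2 : (∀ x, w ⬝ᵥ x = 0) ↔ w = 0 := dotProduct_eq_zero_iff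
  simp only [dotProductBilin_apply_apply, card_bitVec2, h2] at h
  simp only [dotProduct_comm _ w]
  exact_mod_cast h

/-- Fourier inversion: detect B(s,t) = c by summing characters over v; the sum over t then leaves
only s in the radical. -/
theorem valueCount_eq_sum (c : BitVec2 n) :
    (valueCount B c : ℤ) = ∑ v, (-1 : ℤ) ^ (v ⬝ᵥ c).val * (componentRadical B v).card := by
  have hpos : (2 : ℤ) ^ n ≠ 0 := by positivity
  apply mul_left_cancel₀ hpos
  calc (2 : ℤ) ^ n * valueCount B c
      = ∑ p : BitVec2 n × BitVec2 n, ∑ v, (-1 : ℤ) ^ (v ⬝ᵥ (B p.1 p.2 + c)).val := by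
        simp only [sum_neg_one_pow_dotProduct, BitVec2.add_eq_zero_iff, valueCount]
        rw [← Finset.sum_filter, Finset.sum_const, nsmul_eq_mul, mul_comm]
    _ = ∑ v, ∑ s, ∑ t, (-1 : ℤ) ^ (v ⬝ᵥ c).val * (-1) ^ (v ⬝ᵥ B s t).val := by
        rw [Finset.sum_comm]
        refine Finset.sum_congr rfl fun v _ => ?_
        rw [Fintype.sum_prod_type]
        simp only [dotProduct_add, neg_one_pow_val_add, mul_comm]
    _ = _ := by
        rw [Finset.mul_sum]
        refine Finset.sum_congr rfl fun v _ => ?_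
        simp only [← Finset.mul_sum, sum_neg_one_pow_component]
        rw [← Finset.sum_filter, Finset.sum_const, nsmul_eq_mul, Finset.filter_univ_mem]
        ring

theorem componentMatrix_mulVec (v s : BitVec2 n) (i : Fin n) :
    (componentMatrix B v).mulVec s i = v ⬝ᵥ B s (Pi.single i 1) := by
  have hs : s = ∑ j, s j • (Pi.single j 1 : BitVec2 n) := by
    conv_lhs => rw [pi_eq_sum_univ' s]
  conv_rhs => rw [hs]
  simp only [map_sum, LinearMap.sum_apply, map_smul, LinearMap.smul_apply, dotProduct_sum,
    dotProduct_smul]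
  rw [Matrix.mulVec, dotProduct]
  exact Finset.sum_congr rfl fun j _ => mul_comm (v ⬝ᵥ B (Pi.single j 1) (Pi.single i 1)) (s j)

theorem mem_componentRadical_iff_mulVec {v s : BitVec2 n} :
    s ∈ componentRadical B v ↔ (componentMatrix B v).mulVec s = 0 := by
  rw [mem_componentRadical]
  constructor
  · intro h
    ext i
    rw [componentMatrix_mulVec, h, Pi.zero_apply]
  · intro h
    have h2 : (dotProductBilin (ZMod 2) (ZMod 2) v).comp (B s) = 0 := by
      apply LinearMap.pi_ext'
      intro i
      ext
      simpa [componentMatrix_mulVec] using congrFun h i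
    exact fun t => LinearMap.congr_fun h2 t

theorem zero_mem_componentRadical (v : BitVec2 n) : 0 ∈ componentRadical B v := by
  simp [mem_componentRadical]

theorem det_componentMatrix_eq_zero_iff (v : BitVec2 n) :
    (componentMatrix B v).det = 0 ↔ ∃ w ≠ 0, w ∈ componentRadical B v := by
  simp only [mem_componentRadical_iff_mulVec]
  exact Matrix.exists_mulVec_eq_zero_iff.symm

theorem add_mem_componentRadical {v s t : BitVec2 n} (hs : s ∈ componentRadical B v)
    (ht : t ∈ componentRadical B v) : s + t ∈ componentRadical B v := by
  rw [mem_componentRadical_iff_mulVec] at *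
  rw [Matrix.mulVec_add, hs, ht, add_zero]

theorem componentRadical_eq_singleton {v : BitVec2 n} (h : (componentMatrix B v).det ≠ 0) :
    componentRadical B v = {0} := by
  rw [Ne, det_componentMatrix_eq_zero_iff] at h
  push Not at h
  ext s
  rw [Finset.mem_singleton]
  refine ⟨fun hs => by_contra fun h0 => h s h0 hs, ?_⟩
  rintro rfl
  exact zero_mem_componentRadical B v

/-- A nonzero w in the radical makes s ↦ w + s a fixed-point-free involution of it, so its size is
even; otherwise the radical is {0}. -/
theorem card_componentRadical_cast (v : BitVec2 n) :
    ((componentRadical B v).card : ZMod 2) = (componentMatrix B v).det := by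
  by_cases h : (componentMatrix B v).det = 0
  · rw [h]
    obtain ⟨w, hw, hwr⟩ := (det_componentMatrix_eq_zero_iff B v).1 h
    rw [Finset.cast_card]
    refine Finset.sum_involution (fun s _ => w + s) (fun _ _ => by decide) ?_ ?_ ?_
    · intro s _ _ h
      exact hw (by simpa using h)
    · exact fun s hs => add_mem_componentRadical B hwr hs
    · intro s _
      rw [← add_assoc, BitVec2.add_self, zero_add]
  · have : ∀ z : ZMod 2, z ≠ 0 → z = 1 := by decide
    rw [componentRadical_eq_singleton B h, this _ h]
    simp

theorem sum_det_componentMatrix (hsymm : ∀ s t, B s t = B t s) (halt : ∀ s, B s s = 0)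
    (H : AffineSubspace (ZMod 2) (BitVec2 n)) [DecidablePred (· ∈ H)]
    (hcard : n < 2 * Module.finrank (ZMod 2) H.direction) :
    ∑ v with v ∈ H, (componentMatrix B v).det = 0 := by
  apply sum_affineSubspace_det_eq_zero
  · intro v i j
    simp [componentMatrix, hsymm (Pi.single i 1)]
  · intro v i
    simp [componentMatrix, halt]
  · simpa using hcard

end Bilinear

/-! ### Bentness of a component as nonsingularity of its Gram matrix -/

section Bent

variable {n : ℕ} {F : BitVec2 n → BitVec2 n}
  {B : BitVec2 n →ₗ[ZMod 2] BitVec2 n →ₗ[ZMod 2] BitVec2 n}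

/-- Writing the second variable as h + x, the x-dependence of the phase is exactly v · B(h,x), so
only h in the radical survive. -/
theorem walsh_component_sq (hB : ∀ s t, B s t = F (s + t) + F s + F t + F 0) (v u : BitVec2 n) :
    walsh (fun x => v ⬝ᵥ F x) u ^ 2 =
      2 ^ n * ∑ h ∈ componentRadical B v, (-1 : ℤ) ^ (v ⬝ᵥ F h + v ⬝ᵥ F 0 + h ⬝ᵥ u).val := by
  have key : ∀ a b c d e k : ZMod 2,
      (a + b) + (c + (d + b)) = (c + e + a + k) + (e + k + d) := by decide
  calc walsh (fun x => v ⬝ᵥ F x) u ^ 2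
      = ∑ x, ∑ h, (-1 : ℤ) ^ (v ⬝ᵥ F x + x ⬝ᵥ u).val *
          (-1 : ℤ) ^ (v ⬝ᵥ F (h + x) + (h + x) ⬝ᵥ u).val := by
        rw [sq, walsh, Finset.sum_mul]
        refine Finset.sum_congr rfl fun x _ => ?_
        rw [← Finset.mul_sum]
        congr 1
        exact (Equiv.sum_comp (Equiv.addRight x)
          fun y => (-1 : ℤ) ^ (v ⬝ᵥ F y + y ⬝ᵥ u).val).symm
    _ = ∑ h, (-1 : ℤ) ^ (v ⬝ᵥ F h + v ⬝ᵥ F 0 + h ⬝ᵥ u).val *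
          ∑ x, (-1 : ℤ) ^ (v ⬝ᵥ B h x).val := by
        rw [Finset.sum_comm]
        refine Finset.sum_congr rfl fun h _ => ?_
        rw [Finset.mul_sum]
        refine Finset.sum_congr rfl fun x _ => ?_
        rw [← neg_one_pow_val_add, mul_comm, ← neg_one_pow_val_add, hB, add_dotProduct]
        simp only [dotProduct_add]
        rw [key]
    _ = _ := by
        simp only [sum_neg_one_pow_component, mul_ite, mul_zero]
        rw [← Finset.sum_filter, Finset.filter_univ_mem, Finset.mul_sum]
        exact Finset.sum_congr rfl fun h _ => mul_comm _ _

theorem isBent_iff_linearity_sq (f : BitVec2 n → ZMod 2) : IsBent f ↔ linearity f ^ 2 = 2 ^ n := by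
  have h2 : ((2 : ℝ) ^ ((n : ℝ) / 2)) ^ 2 = 2 ^ n := by
    rw [← Real.rpow_natCast, ← Real.rpow_mul (by norm_num)]
    simp
  rw [IsBent, ← sq_eq_sq₀ (by positivity) (by positivity), h2]
  norm_cast

theorem isBent_component_iff (hB : ∀ s t, B s t = F (s + t) + F s + F t + F 0) (v : BitVec2 n) :
    IsBent (fun x => v ⬝ᵥ F x) ↔ (componentMatrix B v).det ≠ 0 := by
  rw [isBent_iff_linearity_sq]
  -- A single u attaining the maximal Walsh value suffices for both directions.
  obtain ⟨u, -, hu⟩ := Finset.exists_mem_eq_sup Finset.univ Finset.univ_nonempty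
    fun u : BitVec2 n => (walsh (fun x => v ⬝ᵥ F x) u).natAbs
  have hsq : ((linearity fun x => v ⬝ᵥ F x : ℕ) : ℤ) ^ 2 = walsh (fun x => v ⬝ᵥ F x) u ^ 2 := by
    rw [linearity, hu, Int.natCast_natAbs, sq_abs]
  rw [walsh_component_sq hB] at hsq
  constructor
  · intro h
    have h1 : ∑ h ∈ componentRadical B v,
        (-1 : ℤ) ^ (v ⬝ᵥ F h + v ⬝ᵥ F 0 + h ⬝ᵥ u).val = 1 := by
      have hpos : (2 : ℤ) ^ n ≠ 0 := by positivity
      apply mul_left_cancel₀ hpos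
      rw [← hsq, mul_one]
      exact_mod_cast h
    -- Modulo 2 the signs vanish and the sum becomes the size of the radical, which is therefore
    -- odd.
    have h2 := congrArg (Int.cast : ℤ → ZMod 2) h1
    have hneg : (-1 : ZMod 2) = 1 := by decide
    rw [← card_componentRadical_cast]
    simp only [Int.cast_sum, Int.cast_pow, Int.cast_neg, Int.cast_one, hneg, one_pow,
      Finset.sum_const, nsmul_eq_mul, mul_one] at h2
    rw [h2]
    exact one_ne_zero
  · intro h
    rw [componentRadical_eq_singleton B h, Finset.sum_singleton, zero_dotProduct,
      CharTwo.add_self_eq_zero, zero_add, ZMod.val_zero, pow_zero, mul_one] at hsq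
    exact_mod_cast hsq

theorem even_ncard_bentComponents_inter (hB : ∀ s t, B s t = F (s + t) + F s + F t + F 0)
    (H : AffineSubspace (ZMod 2) (BitVec2 n)) (hsum : ∀ [DecidablePred (· ∈ H)],
      ∑ v with v ∈ H, (componentMatrix B v).det = 0) :
    Even (bentComponents F ∩ (H : Set (BitVec2 n))).ncard := by
  classical
  have hset : bentComponents F ∩ (H : Set (BitVec2 n)) =
      ((Finset.univ.filter (· ∈ H)).filter fun v => (componentMatrix B v).det ≠ 0 :
        Finset (BitVec2 n)) := by
    ext v
    simp [bentComponents, isBent_component_iff hB, and_comm]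
  rw [hset, Set.ncard_coe_finset, ← ZMod.natCast_eq_zero_iff_even, Finset.cast_card,
    Finset.sum_filter]
  refine Eq.trans ?_ hsum
  refine Finset.sum_congr rfl fun v _ => ?_
  -- Over 𝔽₂ the determinant is its own nonvanishing indicator, so its sum counts bent components
  -- mod 2.
  have : ∀ z : ZMod 2, (if z ≠ 0 then 1 else 0) = z := by decide
  exact this _

end Bent

/-! ### Value counts modulo 4 and their relation to exclude multiplicities -/

section ValueCount

variable {n : ℕ} (B : BitVec2 n →ₗ[ZMod 2] BitVec2 n →ₗ[ZMod 2] BitVec2 n)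

theorem four_dvd_valueCount_zero_add (hn : 3 ≤ n) (hsymm : ∀ s t, B s t = B t s)
    (halt : ∀ s, B s s = 0) {c : BitVec2 n} (hc : c ≠ 0) :
    4 ∣ valueCount B 0 + valueCount B c := by
  classical
  set H : AffineSubspace (ZMod 2) (BitVec2 n) :=
    (dotProductBilin (ZMod 2) (ZMod 2) c).ker.toAffineSubspace with hH
  have hmem : ∀ v, v ∈ H ↔ v ⬝ᵥ c = 0 := fun v => by
    rw [dotProduct_comm]; rfl
  have hrank : Module.finrank (ZMod 2) H.direction + 1 = n := by
    rw [hH, Submodule.toAffineSubspace_direction]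
    have h0 : dotProductBilin (ZMod 2) (ZMod 2) c ≠ 0 := fun h =>
      hc (dotProduct_eq_zero_iff.1 fun w => LinearMap.congr_fun h w)
    simpa using Module.Dual.finrank_ker_add_one_of_ne_zero h0
  have hdet := sum_det_componentMatrix B hsymm halt H (by omega)
  simp only [← card_componentRadical_cast, ← Nat.cast_sum] at hdet
  rw [ZMod.natCast_eq_zero_iff] at hdet
  -- The weight 1 + (-1)^(v · c) is 2 on the hyperplane orthogonal to c and 0 elsewhere.
  have hsum : valueCount B 0 + valueCount B c =
      2 * ∑ v with v ∈ H, (componentRadical B v).card := by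
    zify
    rw [valueCount_eq_sum, valueCount_eq_sum, ← Finset.sum_add_distrib, Finset.sum_filter,
      Finset.mul_sum]
    refine Finset.sum_congr rfl fun v _ => ?_
    rw [dotProduct_zero, ← add_mul, hmem]
    have : ∀ z : ZMod 2, (-1 : ℤ) ^ (0 : ZMod 2).val + (-1) ^ z.val = if z = 0 then 2 else 0 := by
      decide
    rw [this]
    split_ifs <;> simp
  rw [hsum]
  exact Nat.mul_dvd_mul_left 2 hdet

/-- The slice s = 0 contributes 2^n and each of the other 2^n - 1 slices contributes 2. -/
theorem valueCount_zero_of_card (h : ∀ s ≠ 0, (Finset.univ.filter fun t => B s t = 0).card = 2) :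
    valueCount B 0 + 2 = 3 * 2 ^ n := by
  have h1 : valueCount B 0 = ∑ s, (Finset.univ.filter fun t => B s t = 0).card := by
    simp only [valueCount, Finset.card_filter]
    exact Fintype.sum_prod_type _
  have h2 : ∑ s ∈ Finset.univ.erase 0, (Finset.univ.filter fun t => B s t = 0).card =
      (2 ^ n - 1) * 2 := by
    rw [Finset.sum_congr rfl fun s hs => h s (Finset.ne_of_mem_erase hs), Finset.sum_const,
      Finset.card_erase_of_mem (Finset.mem_univ _), Finset.card_univ, card_bitVec2, smul_eq_mul]
  rw [h1, ← Finset.add_sum_erase _ _ (Finset.mem_univ 0), h2]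
  simp only [map_zero, LinearMap.zero_apply, Finset.filter_true, Finset.card_univ, card_bitVec2]
  have := Nat.one_le_two_pow (n := n)
  omega

/-- B(s,t) = 0 is the equation D_sF(t) = F(s) + F(0): APN allows at most two solutions, and t = 0, t
= s are two. -/
theorem IsAPN.card_filter_bilinear {F : BitVec2 n → BitVec2 n} (hF : IsAPN F)
    (hB : ∀ s t, B s t = F (s + t) + F s + F t + F 0) (halt : ∀ s, B s s = 0) {s : BitVec2 n}
    (hs : s ≠ 0) : (Finset.univ.filter fun t => B s t = 0).card = 2 := by
  have heq : (Finset.univ.filter fun t => B s t = 0) =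
      Finset.univ.filter fun t => derivDir F s t = F s + F 0 := by
    refine Finset.filter_congr fun t _ => ?_
    have h1 : B s t = derivDir F s t + (F s + F 0) := by
      rw [hB, derivDir, add_comm s t]; abel
    rw [h1, BitVec2.add_eq_zero_iff]
  refine le_antisymm (heq ▸ hF s hs _) ?_
  refine (Finset.card_pair hs).symm.trans_le (Finset.card_le_card fun t ht => ?_)
  rw [Finset.mem_insert, Finset.mem_singleton] at ht
  rw [Finset.mem_filter_univ]
  rcases ht with rfl | rfl
  · exact halt t
  · exact map_zero _

variable {F : BitVec2 n → BitVec2 n}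

theorem BitVec2.sub_eq_add (x y : BitVec2 n) : x - y = x + y :=
  funext fun i => CharTwo.sub_eq_add (x i) (y i)

/-- The second derivative of a quadratic function does not depend on the base point; this moves it
from 0 to a. -/
theorem bilinear_eq_sum_translates (hB : ∀ s t, B s t = F (s + t) + F s + F t + F 0)
    (a s t : BitVec2 n) : B s t = F (a + s) + F (a + t) + F (a + s + t) + F a := by
  have h : B s t = B (a + s) t + B a t := by
    rw [map_add, LinearMap.add_apply, add_right_comm, BitVec2.add_self, zero_add]
  have key : ∀ p q r x y z : ZMod 2,
      p + q + r + x + (y + z + r + x) = q + y + p + z := by decide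
  rw [h, hB, hB]
  exact funext fun i => key _ _ _ _ _ _

/-- The three points of the graph of `F` above `a + s`, `a + t` and `a + s + t`. -/
def graphTriple (F : BitVec2 n → BitVec2 n) (a : BitVec2 n) (p : BitVec2 n × BitVec2 n) :
    Finset (BitVec2 n × BitVec2 n) :=
  {(a + p.1, F (a + p.1)), (a + p.2, F (a + p.2)), (a + p.1 + p.2, F (a + p.1 + p.2))}

theorem graphTriple_pairwise_ne (halt : ∀ s, B s s = 0) (a : BitVec2 n)
    {p : BitVec2 n × BitVec2 n} (hp : B p.1 p.2 ≠ 0) :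
    (a + p.1, F (a + p.1)) ≠ (a + p.2, F (a + p.2)) ∧
    (a + p.1, F (a + p.1)) ≠ (a + p.1 + p.2, F (a + p.1 + p.2)) ∧
    (a + p.2, F (a + p.2)) ≠ (a + p.1 + p.2, F (a + p.1 + p.2)) := by
  have h1 : p.1 ≠ 0 := fun h => hp (by rw [h, map_zero, LinearMap.zero_apply])
  have h2 : p.2 ≠ 0 := fun h => hp (by rw [h, map_zero])
  have h3 : p.1 ≠ p.2 := fun h => hp (by rw [h, halt])
  refine ⟨?_, ?_, ?_⟩
  · exact fun h => h3 (add_left_cancel (congrArg Prod.fst h))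
  · exact fun h => h2 (by simpa using congrArg Prod.fst h)
  · refine fun h => h1 ?_
    have := congrArg Prod.fst h
    simpa [add_right_comm a] using this

theorem card_graphTriple (halt : ∀ s, B s s = 0) (a : BitVec2 n) {p : BitVec2 n × BitVec2 n}
    (hp : B p.1 p.2 ≠ 0) : (graphTriple F a p).card = 3 := by
  obtain ⟨h1, h2, h3⟩ := graphTriple_pairwise_ne B (F := F) halt a hp
  exact Finset.card_eq_three.2 ⟨_, _, _, h1, h2, h3, rfl⟩

theorem sum_graphTriple (hB : ∀ s t, B s t = F (s + t) + F s + F t + F 0)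
    (halt : ∀ s, B s s = 0) {a b : BitVec2 n} {p : BitVec2 n × BitVec2 n} (hp : B p.1 p.2 ≠ 0)
    (hpb : B p.1 p.2 = b + F a) : ∑ x ∈ graphTriple F a p, x = (a, b) := by
  obtain ⟨h1, h2, h3⟩ := graphTriple_pairwise_ne B (F := F) halt a hp
  rw [graphTriple, Finset.sum_insert (by simp only [Finset.mem_insert, Finset.mem_singleton]; tauto),
    Finset.sum_insert (by rwa [Finset.mem_singleton]), Finset.sum_singleton]
  have hF := bilinear_eq_sum_translates B hB a p.1 p.2
  rw [hpb] at hF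
  have hb := add_right_cancel hF
  have key : ∀ x y z : ZMod 2, x + y + (x + z + (x + y + z)) = x := by decide
  refine Prod.ext (funext fun i => key _ _ _) ?_
  rw [hb]
  exact (add_assoc _ _ _).symm

theorem eq_insert_insert_of_sum {G : Type*} [AddCommGroup G] [DecidableEq G] {T : Finset G}
    (hT : T.card = 3) {p q : G} (hp : p ∈ T) (hq : q ∈ T) (hpq : p ≠ q) :
    T = {p, q, ∑ x ∈ T, x - p - q} := by
  have hq' : q ∈ T.erase p := Finset.mem_erase.2 ⟨hpq.symm, hq⟩
  obtain ⟨r, hr⟩ : ∃ r, (T.erase p).erase q = {r} := by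
    rw [← Finset.card_eq_one, Finset.card_erase_of_mem hq', Finset.card_erase_of_mem hp, hT]
  have hsum : ∑ x ∈ T, x = p + (q + r) := by
    rw [← Finset.add_sum_erase _ _ hp, ← Finset.add_sum_erase _ _ hq', hr, Finset.sum_singleton]
  rw [hsum, add_sub_cancel_left, add_sub_cancel_left, ← hr, Finset.insert_erase hq',
    Finset.insert_erase hp]

/-- Each pair (s,t) with B(s,t) = b + F(a) yields the triple of graph points above a+s, a+t, a+s+t,
with sum (a,b). Conversely, an ordered pair of distinct points of such a triple determines the third
point and recovers (s,t), so every fibre has 3·2 elements. -/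
theorem valueCount_eq_six_mul (hB : ∀ s t, B s t = F (s + t) + F s + F t + F 0)
    (halt : ∀ s, B s s = 0) {a b : BitVec2 n} (hab : b + F a ≠ 0) :
    valueCount B (b + F a) = 6 * excludeMult (graphFinset F) (a, b) := by
  have hgraph : ∀ x : BitVec2 n × BitVec2 n, x ∈ graphFinset F ↔ x.2 = F x.1 := fun x =>
    Finset.mem_filter_univ x
  have hne : ∀ p : BitVec2 n × BitVec2 n, B p.1 p.2 = b + F a → B p.1 p.2 ≠ 0 := fun p hp =>
    hp ▸ hab
  have hmaps : ∀ p ∈ Finset.univ.filter fun p : BitVec2 n × BitVec2 n => B p.1 p.2 = b + F a,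
      graphTriple F a p ∈
        ((graphFinset F).powersetCard 3).filter fun T => ∑ x ∈ T, x = (a, b) := by
    intro p hp
    rw [Finset.mem_filter_univ] at hp
    rw [Finset.mem_filter, Finset.mem_powersetCard]
    refine ⟨⟨fun x hx => ?_, card_graphTriple B halt a (hne p hp)⟩,
      sum_graphTriple B hB halt (hne p hp) hp⟩
    simp only [graphTriple, Finset.mem_insert, Finset.mem_singleton] at hx
    rw [hgraph]
    rcases hx with rfl | rfl | rfl <;> rfl
  rw [valueCount, excludeMult, Finset.card_eq_sum_card_fiberwise hmaps, mul_comm, ← smul_eq_mul]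
  apply Finset.sum_const_nat
  intro T hT
  rw [Finset.mem_filter, Finset.mem_powersetCard] at hT
  obtain ⟨⟨hTF, hT3⟩, hsum⟩ := hT
  have hoff : T.offDiag.card = 6 := by rw [Finset.offDiag_card, hT3]
  rw [← hoff]
  refine Finset.card_nbij'
    (fun p => ((a + p.1, F (a + p.1)), (a + p.2, F (a + p.2))))
    (fun x => (a + x.1.1, a + x.2.1)) ?_ ?_ ?_ ?_
  · intro p hp
    simp only [Finset.coe_filter, Finset.mem_filter, Finset.mem_univ, true_and,
      Set.mem_ofPred_eq] at hp
    obtain ⟨hp, rfl⟩ := hp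
    rw [Finset.mem_coe, Finset.mem_offDiag]
    refine ⟨by simp [graphTriple], by simp [graphTriple], fun h => hne p hp ?_⟩
    rw [add_left_cancel (congrArg Prod.fst h), halt]
  · intro x hx
    rw [Finset.mem_coe, Finset.mem_offDiag] at hx
    obtain ⟨h1, h2, h12⟩ := hx
    have hT := eq_insert_insert_of_sum hT3 h1 h2 h12
    have e1 := (hgraph _).1 (hTF h1)
    have e2 := (hgraph _).1 (hTF h2)
    -- The third point also lies on the graph; this is what forces the value of B.
    have h3 : ∑ x ∈ T, x - x.1 - x.2 ∈ T :=
      (Finset.ext_iff.1 hT _).2 (by simp only [Finset.mem_insert, Finset.mem_singleton, or_true])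
    have e3 := (hgraph _).1 (hTF h3)
    rw [hsum] at hT e3
    obtain ⟨⟨u, u'⟩, ⟨v, v'⟩⟩ := x
    dsimp only at e1 e2
    subst e1 e2
    have e4 : (a, b) - (u, F u) - (v, F v) = (a + u + v, b + F u + F v) := by
      rw [Prod.mk_sub_mk, Prod.mk_sub_mk]; simp only [BitVec2.sub_eq_add]
    rw [e4] at hT e3
    dsimp only at e3
    have hu : a + (a + u) = u := by rw [← add_assoc, BitVec2.add_self, zero_add]
    have hv : a + (a + v) = v := by rw [← add_assoc, BitVec2.add_self, zero_add]
    have huv : u + (a + v) = a + u + v := by abel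
    simp only [Finset.coe_filter, Finset.mem_filter, Finset.mem_univ, true_and,
      Set.mem_ofPred_eq]
    constructor
    · rw [bilinear_eq_sum_translates B hB a, hu, hv, huv, ← e3]
      have key : ∀ x y z w : ZMod 2, x + y + (z + x + y) + w = z + w := by decide
      exact funext fun i => key _ _ _ _
    · rw [hT, e3, graphTriple]
      simp only [hu, hv, huv]
  · intro p _
    simp only [← add_assoc, BitVec2.add_self, zero_add]
  · intro x hx
    rw [Finset.mem_coe, Finset.mem_offDiag] at hx
    simp only [← add_assoc, BitVec2.add_self, zero_add]
    rw [← (hgraph _).1 (hTF hx.1), ← (hgraph _).1 (hTF hx.2.1)]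

end ValueCount

/-! ### The main theorem -/

theorem mainTheorem5 (n : ℕ) (hn : 3 ≤ n) (F : BitVec2 n → BitVec2 n)
    (hquad : IsQuadratic F) (hAPN : IsAPN F) :
    (∀ a b : BitVec2 n, (a, b) ∉ graphFinset F → Odd (excludeMult (graphFinset F) (a, b))) ∧
    (∀ H : AffineSubspace (ZMod 2) (BitVec2 n), IsAffineHyperplane H →
      Even (bentComponents F ∩ (H : Set (BitVec2 n))).ncard) := by
  obtain ⟨B, hB⟩ := hquad.exists_bilinear
  have hsymm : ∀ s t, B s t = B t s := fun s t => by
    rw [hB, hB, add_comm s t]; abel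
  have halt : ∀ s, B s s = 0 := fun s => by
    rw [hB, BitVec2.add_self, add_assoc (F 0), BitVec2.add_self, add_zero, BitVec2.add_self]
  constructor
  · intro a b hab
    have hc : b + F a ≠ 0 := fun h => hab <| by
      rw [graphFinset, Finset.mem_filter_univ]
      exact BitVec2.add_eq_zero_iff.1 h
    have h1 := four_dvd_valueCount_zero_add B hn hsymm halt hc
    have h2 := valueCount_zero_of_card B fun s hs => hAPN.card_filter_bilinear B hB halt hs
    rw [valueCount_eq_six_mul B hB halt hc] at h1
    -- With m the multiplicity, 4 divides 3·2^n - 2 + 6m, hence 6m ≡ 2 mod 4 and m is odd.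
    have h3 : 4 ∣ 2 ^ n := pow_dvd_pow 2 (show 2 ≤ n by omega)
    rw [Nat.odd_iff]
    omega
  · rintro H ⟨-, hH⟩
    -- The degree bound needs n < 2(n - 1), which is n ≥ 3.
    exact even_ncard_bentComponents_inter hB H (sum_det_componentMatrix B hsymm halt H (by omega))
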